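/- Let $1\le p<\infty$, and let $\mathcal F_p$ be the Fock space of all entire functions $f:\mathbb C\to\mathbb C$ with $$\|f\|_p^p=\frac{p}{2\pi}\int_{\mathbb C}|f(z)|^p e^{-\frac{p|z|^2}{2}}\,dA(z)<\infty,$$ where $dA$ is Lebesgue area measure on $\mathbb C$. Let $u,\psi$ be entire functions such that the weighted composition operator $W_{(u,\psi)}f=u\cdot(f\circ\psi)$ is a bounded linear operator from $\mathcal F_p$ to $\mathcal F_p$. Then $W_{(u,\psi)}$ is not supercyclic on $\mathcal F_p$; that is, for no $f\in\mathcal F_p$ is the projective orbit $\{c\,W_{(u,\psi)}^n f : c\in\mathbb C,\ n\in\mathbb N_0\}$ dense in $\mathcal F_p$. -/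

import Mathlib

open MeasureTheory
open scoped ENNReal

noncomputable section

/-- The Gaussian probability density `p / (2π) · exp (-p |z|² / 2)` on `ℂ`. -/
def fockWeight (p : ℝ) (z : ℂ) : ℝ :=
  p / (2 * Real.pi) * Real.exp (-(p * ‖z‖ ^ 2 / 2))

/-- The measure with density `p / (2π) · exp (-p |z|² / 2)` with respect to Lebesgue area measure.
It only serves to obtain the vector space and norm axioms below from the theory of `L^p`. -/
def fockMeasure (p : ℝ) : Measure ℂ :=
  volume.withDensity fun z => ENNReal.ofReal (fockWeight p z)

/-- Membership in the Fock space: `f` is entire and `|f|^p exp (-p |z|² / 2)` is integrable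
with respect to Lebesgue area measure. -/
def MemFock (p : ℝ) (f : ℂ → ℂ) : Prop :=
  Differentiable ℂ f ∧
    Integrable (fun z : ℂ => ‖f z‖ ^ p * Real.exp (-(p * ‖z‖ ^ 2 / 2))) volume

/-- `‖f‖_p = (p / (2π) ∫ |f|^p exp (-p |z|² / 2) dA)^(1/p)`. -/
def fockNorm (p : ℝ) (f : ℂ → ℂ) : ℝ :=
  (p / (2 * Real.pi) * ∫ z : ℂ, ‖f z‖ ^ p * Real.exp (-(p * ‖z‖ ^ 2 / 2))) ^ (1 / p)

theorem fockWeight_pos {p : ℝ} (hp : 0 < p) (z : ℂ) : 0 < fockWeight p z := by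
  unfold fockWeight; positivity

theorem continuous_fockWeight (p : ℝ) : Continuous (fockWeight p) := by
  unfold fockWeight; fun_prop

theorem eLpNorm_fockMeasure {p : ℝ} (hp : 0 < p) (f : ℂ → ℂ) :
    eLpNorm f (ENNReal.ofReal p) (fockMeasure p) =
      (∫⁻ z, ENNReal.ofReal (fockWeight p z * ‖f z‖ ^ p)) ^ (1 / p) := by
  rw [eLpNorm_eq_lintegral_rpow_enorm_toReal (by simpa using hp) ENNReal.ofReal_ne_top,
    ENNReal.toReal_ofReal hp.le, fockMeasure,
    lintegral_withDensity_eq_lintegral_mul_non_measurable _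
      (continuous_fockWeight p).measurable.ennreal_ofReal (by simp)]
  congr 2
  ext z
  simp only [Pi.mul_apply]
  rw [ENNReal.ofReal_mul (fockWeight_pos hp z).le,
    ← ENNReal.ofReal_rpow_of_nonneg (norm_nonneg _) hp.le, ofReal_norm]

theorem fock_integrand_eq (p : ℝ) (f : ℂ → ℂ) :
    (fun z => fockWeight p z * ‖f z‖ ^ p) =
      fun z => p / (2 * Real.pi) * (‖f z‖ ^ p * Real.exp (-(p * ‖z‖ ^ 2 / 2))) := by
  ext z; unfold fockWeight; ring

theorem memFock_iff {p : ℝ} (hp : 0 < p) (f : ℂ → ℂ) :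
    MemFock p f ↔ Differentiable ℂ f ∧ MemLp f (ENNReal.ofReal p) (fockMeasure p) := by
  unfold MemFock
  refine and_congr_right fun hf => ?_
  have hc : Continuous fun z : ℂ => fockWeight p z * ‖f z‖ ^ p :=
    (continuous_fockWeight p).mul (hf.continuous.norm.rpow_const fun _ => Or.inr hp.le)
  have h0 : ∀ z, 0 ≤ fockWeight p z * ‖f z‖ ^ p := fun z =>
    mul_nonneg (fockWeight_pos hp z).le (by positivity)
  have h1 : Integrable (fun z : ℂ => ‖f z‖ ^ p * Real.exp (-(p * ‖z‖ ^ 2 / 2))) volume ↔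
      Integrable (fun z : ℂ => fockWeight p z * ‖f z‖ ^ p) volume := by
    rw [fock_integrand_eq, integrable_const_mul_iff]
    exact isUnit_iff_ne_zero.mpr (by positivity)
  have h2 : Integrable (fun z : ℂ => fockWeight p z * ‖f z‖ ^ p) volume ↔
      ∫⁻ z, ENNReal.ofReal (fockWeight p z * ‖f z‖ ^ p) ≠ ∞ :=
    (lintegral_ofReal_ne_top_iff_integrable hc.aestronglyMeasurable
      (Filter.Eventually.of_forall h0)).symm
  rw [h1, h2, MemLp, eLpNorm_fockMeasure hp, ← lt_top_iff_ne_top,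
    ENNReal.rpow_lt_top_iff_of_pos (by positivity)]
  exact ⟨fun h => ⟨hf.continuous.aestronglyMeasurable, h⟩, fun h => h.2⟩

theorem fockNorm_eq {p : ℝ} (hp : 0 < p) {f : ℂ → ℂ} (hf : Differentiable ℂ f) :
    fockNorm p f = (eLpNorm f (ENNReal.ofReal p) (fockMeasure p)).toReal := by
  have hc : Continuous fun z : ℂ => fockWeight p z * ‖f z‖ ^ p :=
    (continuous_fockWeight p).mul (hf.continuous.norm.rpow_const fun _ => Or.inr hp.le)
  have h0 : ∀ z, 0 ≤ fockWeight p z * ‖f z‖ ^ p := fun z =>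
    mul_nonneg (fockWeight_pos hp z).le (by positivity)
  rw [eLpNorm_fockMeasure hp, ← ENNReal.toReal_rpow,
    ← integral_eq_lintegral_of_nonneg_ae (Filter.Eventually.of_forall h0) hc.aestronglyMeasurable,
    fock_integrand_eq, integral_const_mul, fockNorm]

/-- The Fock space as a subspace of the space of all functions `ℂ → ℂ`. -/
def fockSubmodule (p : ℝ) [hp : Fact (1 ≤ p)] : Submodule ℂ (ℂ → ℂ) where
  carrier := {f | MemFock p f}
  zero_mem' := (memFock_iff (zero_lt_one.trans_le hp.out) _).2
    ⟨differentiable_const 0, MemLp.zero⟩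
  add_mem' {f g} hf hg := by
    have h := zero_lt_one.trans_le hp.out
    have hf' := (memFock_iff h f).1 hf
    have hg' := (memFock_iff h g).1 hg
    exact (memFock_iff h _).2 ⟨hf'.1.add hg'.1, hf'.2.add hg'.2⟩
  smul_mem' c f hf := by
    have h := zero_lt_one.trans_le hp.out
    have hf' := (memFock_iff h f).1 hf
    exact (memFock_iff h _).2 ⟨hf'.1.const_smul c, hf'.2.const_smul c⟩

/-- The Fock space `F_p`. A separate type, so that its topology is that of the norm `fockNorm`
and not the topology of pointwise convergence inherited from `ℂ → ℂ`. -/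
def FockSpace (p : ℝ) [Fact (1 ≤ p)] : Type := fockSubmodule p

namespace FockSpace

variable {p : ℝ} [hp : Fact (1 ≤ p)]

instance : AddCommGroup (FockSpace p) := inferInstanceAs (AddCommGroup (fockSubmodule p))

instance : Module ℂ (FockSpace p) := inferInstanceAs (Module ℂ (fockSubmodule p))

instance : CoeFun (FockSpace p) fun _ => ℂ → ℂ := ⟨fun f => f.1⟩

/-- Bundle a function that lies in the Fock space. -/
def mk (f : ℂ → ℂ) (hf : MemFock p f) : FockSpace p := ⟨f, hf⟩

@[simp] theorem coe_mk (f : ℂ → ℂ) (hf : MemFock p f) : (mk f hf : ℂ → ℂ) = f := rfl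

@[ext] theorem ext {f g : FockSpace p} (h : ∀ z, f z = g z) : f = g :=
  Subtype.ext (funext h)

theorem memFock (f : FockSpace p) : MemFock p f := f.2

@[simp] theorem coe_zero : ((0 : FockSpace p) : ℂ → ℂ) = 0 := rfl

@[simp] theorem coe_add (f g : FockSpace p) : ((f + g : FockSpace p) : ℂ → ℂ) = f + g := rfl

@[simp] theorem coe_smul (c : ℂ) (f : FockSpace p) : ((c • f : FockSpace p) : ℂ → ℂ) = c • f := rfl

instance : Norm (FockSpace p) := ⟨fun f => fockNorm p f⟩

theorem norm_def (f : FockSpace p) : ‖f‖ = fockNorm p f := rfl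

theorem norm_eq (f : FockSpace p) :
    ‖f‖ = (eLpNorm f (ENNReal.ofReal p) (fockMeasure p)).toReal :=
  fockNorm_eq (zero_lt_one.trans_le hp.out) f.memFock.1

theorem memLp (f : FockSpace p) : MemLp f (ENNReal.ofReal p) (fockMeasure p) :=
  ((memFock_iff (zero_lt_one.trans_le hp.out) _).1 f.memFock).2

theorem normCore : NormedSpace.Core ℂ (FockSpace p) where
  norm_nonneg f := by rw [norm_eq]; exact ENNReal.toReal_nonneg
  norm_smul c f := by
    rw [norm_eq, norm_eq, coe_smul, eLpNorm_const_smul, ENNReal.toReal_mul, toReal_enorm]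
  norm_triangle f g := by
    rw [norm_eq, norm_eq, norm_eq, coe_add,
      ← ENNReal.toReal_add f.memLp.eLpNorm_ne_top g.memLp.eLpNorm_ne_top]
    refine ENNReal.toReal_mono
      (ENNReal.add_ne_top.2 ⟨f.memLp.eLpNorm_ne_top, g.memLp.eLpNorm_ne_top⟩) ?_
    refine eLpNorm_add_le f.memLp.1 g.memLp.1 ?_
    simpa using hp.out
  norm_eq_zero_iff f := by
    have h := zero_lt_one.trans_le hp.out
    constructor
    · intro hf
      rw [norm_eq, ENNReal.toReal_eq_zero_iff, or_iff_left f.memLp.eLpNorm_ne_top,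
        eLpNorm_eq_zero_iff f.memLp.1 (by simpa using h), fockMeasure, Filter.EventuallyEq,
        ae_withDensity_iff (continuous_fockWeight p).measurable.ennreal_ofReal] at hf
      have hf' : (f : ℂ → ℂ) =ᵐ[volume] 0 := by
        filter_upwards [hf] with z hz
        exact hz (by simpa using fockWeight_pos h z)
      have := (f.memFock.1.continuous.ae_eq_iff_eq volume continuous_zero).1 hf'
      exact ext fun z => congrFun this z
    · rintro rfl
      rw [norm_eq, coe_zero, eLpNorm_zero, ENNReal.toReal_zero]

instance : NormedAddCommGroup (FockSpace p) := NormedAddCommGroup.ofCore normCore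

instance : NormedSpace ℂ (FockSpace p) := NormedSpace.ofCore normCore

end FockSpace

/-- A bounded operator `T` is supercyclic if some vector has a dense projective orbit
`{c • T^n f : c ∈ ℂ, n ∈ ℕ}` (with `T^0 = I`). -/
def IsSupercyclic {X : Type*} [NormedAddCommGroup X] [NormedSpace ℂ X] (T : X →L[ℂ] X) : Prop :=
  ∃ f : X, Dense {g : X | ∃ (c : ℂ) (n : ℕ), g = c • (T ^ n) f}

/-- The operator `W` on `F_p` is the weighted composition operator `f ↦ u · (f ∘ ψ)`. -/
def IsWeightedComposition {p : ℝ} [Fact (1 ≤ p)] (u ψ : ℂ → ℂ)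
    (W : FockSpace p →L[ℂ] FockSpace p) : Prop :=
  ∀ (f : FockSpace p) (z : ℂ), W f z = u z * f (ψ z)

end

open Filter Topology Metric ComplexConjugate

/-! A logarithmic derivative ignores scalar factors, and that of `exp (τ z)` is `τ`. So if the
projective orbit of `f` is dense, then at each fixed `z` the logarithmic derivatives of those `W ^ n
f` that do not vanish at `z` are dense in `ℂ` (`exists_norm_logDeriv_sub_lt`). Each case contradicts
this density.

If `u` vanishes at `z`, only `n = 0` contributes. If `ψ` fixes `z`, these numbers form an orbit of
an affine map of the plane, which is never dense (`exists_forall_le_norm_sub_of_affine_recurrence`).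

Otherwise `u` has no zeros and `log |u|` is harmonic. Testing `W` on exponentials bounds `|u| exp
(|ψ|² / 2)` by a multiple of `exp (|z|² / 2)`; taking circle means, `ψ` grows at most linearly in
mean and is affine. Having no fixed point, it is a translation, and Liouville's theorem makes `W` a
multiple of a Weyl translation, hence of an isometry. Then `|W ^ n f 0| / ‖W ^ n f‖` tends to zero,
while this ratio is bounded below near `exp (τ z)` for `|τ| ≤ 1`. Only finitely many `n` can
approximate those exponentials, too few to fill a disc of values `τ`. -/

/-! ### Mean values and the weighted modulus -/

/-- The area mean value property of entire functions on the unit disc. -/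
theorem integral_closedBall_of_differentiable {h : ℂ → ℂ} (hh : Differentiable ℂ h) :
    ∫ η in closedBall (0 : ℂ) 1, h η = (Real.pi : ℂ) * h 0 := by
  have hc := hh.continuous
  -- Average over all rotations: the disc integral does not see `θ`, while for fixed `η` the mean
  -- over `θ` is `h 0`.
  have hrot (θ : ℝ) : ∫ η in closedBall (0 : ℂ) 1, h (Complex.exp (θ * Complex.I) * η) =
      ∫ η in closedBall (0 : ℂ) 1, h η := by
    have e := (rotation (Circle.exp θ)).measurePreserving.setIntegral_preimage_emb
      (rotation (Circle.exp θ)).toMeasurableEquiv.measurableEmbedding h (closedBall (0 : ℂ) 1)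
    rw [LinearIsometryEquiv.preimage_closedBall, map_zero] at e
    simpa [rotation_apply, Circle.coe_exp] using e
  have hmean (η : ℂ) : ∫ θ in (0 : ℝ)..(2 * Real.pi), h (Complex.exp (θ * Complex.I) * η) =
      2 * Real.pi * h 0 := by
    have hg : Differentiable ℂ fun ζ => h (ζ * η) := hh.comp (differentiable_id.mul_const η)
    have e := (hg.diffContOnCl (s := ball 0 |1|)).circleAverage
    rw [Real.circleAverage_def, zero_mul] at e
    simp only [circleMap_zero, Complex.ofReal_one, one_mul] at e
    have hne : (2 * Real.pi : ℂ) ≠ 0 := by simp [Real.pi_ne_zero]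
    rw [← e, Complex.real_smul, ← mul_assoc]
    push_cast
    rw [mul_inv_cancel₀ hne, one_mul]
  have hswap : ∫ θ in Set.Icc (0 : ℝ) (2 * Real.pi), ∫ η in closedBall (0 : ℂ) 1,
        h (Complex.exp (θ * Complex.I) * η) =
      ∫ η in closedBall (0 : ℂ) 1, ∫ θ in Set.Icc (0 : ℝ) (2 * Real.pi),
        h (Complex.exp (θ * Complex.I) * η) := by
    refine integral_integral_swap ?_
    rw [Measure.prod_restrict]
    refine ContinuousOn.integrableOn_compact (isCompact_Icc.prod (isCompact_closedBall _ _)) ?_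
    exact Continuous.continuousOn (by fun_prop)
  have hpi : (0 : ℝ) ≤ 2 * Real.pi := by positivity
  simp only [integral_Icc_eq_integral_Ioc, ← intervalIntegral.integral_of_le hpi, hrot, hmean]
    at hswap
  rw [intervalIntegral.integral_const, setIntegral_const, Measure.real, Complex.volume_closedBall]
    at hswap
  simp only [sub_zero, Complex.real_smul, ENNReal.ofReal_one, one_pow, one_mul,
    ENNReal.coe_toReal, NNReal.coe_real_pi, Complex.ofReal_mul, Complex.ofReal_ofNat] at hswap
  have hne : (2 * Real.pi : ℂ) ≠ 0 := by simp [Real.pi_ne_zero]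
  exact mul_left_cancel₀ hne (by rw [hswap]; ring)

/-- The `p`-th power of the modulus of an entire function is at most its mean over a disc. -/
theorem norm_rpow_le_integral_closedBall {p : ℝ} (hp : 1 ≤ p) {h : ℂ → ℂ}
    (hh : Differentiable ℂ h) :
    ‖h 0‖ ^ p ≤ Real.pi⁻¹ * ∫ η in closedBall (0 : ℂ) 1, ‖h η‖ ^ p := by
  have hp0 : 0 ≤ p := zero_le_one.trans hp
  have hvol : volume.real (closedBall (0 : ℂ) 1) = Real.pi := by
    simp [Measure.real, Complex.volume_closedBall]
  have hint {g : ℂ → ℝ} (hg : Continuous g) : IntegrableOn g (closedBall (0 : ℂ) 1) :=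
    hg.continuousOn.integrableOn_compact (isCompact_closedBall _ _)
  have hc : Continuous fun η => ‖h η‖ := hh.continuous.norm
  -- Jensen's inequality for `x ↦ x ^ p`; this is where `1 ≤ p` enters.
  have hj := (convexOn_rpow hp).map_set_average_le (μ := volume) (t := closedBall (0 : ℂ) 1)
    (f := fun η => ‖h η‖) (Real.continuous_rpow_const hp0).continuousOn isClosed_Ici
    (by simp [Complex.volume_closedBall, NNReal.pi_ne_zero])
    (isCompact_closedBall _ _).measure_lt_top.ne
    (Eventually.of_forall fun η => norm_nonneg _) (hint hc)
    (hint (hc.rpow_const fun _ => Or.inr hp0))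
  rw [setAverage_eq, setAverage_eq, hvol, smul_eq_mul, smul_eq_mul] at hj
  refine le_trans (Real.rpow_le_rpow (norm_nonneg _) ?_ hp0) hj
  have e := norm_integral_le_integral_norm (μ := volume.restrict (closedBall (0 : ℂ) 1)) h
  rw [integral_closedBall_of_differentiable hh, norm_mul, Complex.norm_real,
    Real.norm_of_nonneg Real.pi_pos.le] at e
  rwa [le_inv_mul_iff₀ Real.pi_pos]

/-- The integrand `|f|^p exp (-p |z|² / 2)` of the Fock norm. -/
noncomputable def fockDensity (p : ℝ) (f : ℂ → ℂ) (z : ℂ) : ℝ :=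
  ‖f z‖ ^ p * Real.exp (-(p * ‖z‖ ^ 2 / 2))

theorem fockDensity_nonneg (p : ℝ) (f : ℂ → ℂ) (z : ℂ) : 0 ≤ fockDensity p f z := by
  unfold fockDensity; positivity

theorem continuous_fockDensity {p : ℝ} (hp : 0 ≤ p) {f : ℂ → ℂ} (hf : Continuous f) :
    Continuous (fockDensity p f) := by
  unfold fockDensity
  exact (hf.norm.rpow_const fun _ => Or.inr hp).mul (by fun_prop)

theorem fockDensity_eq_rpow (p : ℝ) (f : ℂ → ℂ) (z : ℂ) :
    fockDensity p f z = (‖f z‖ * Real.exp (-(‖z‖ ^ 2 / 2))) ^ p := by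
  rw [Real.mul_rpow (norm_nonneg _) (Real.exp_pos _).le, ← Real.exp_mul, fockDensity]
  congr 2; ring

/-- The effect of a Weyl translation on the weighted modulus. -/
theorem norm_weyl_mul_exp (c b z x : ℂ) :
    ‖c * Complex.exp (-(conj b * z)) * x‖ * Real.exp (-(‖z‖ ^ 2 / 2)) =
      ‖c‖ * Real.exp (‖b‖ ^ 2 / 2) * (‖x‖ * Real.exp (-(‖z + b‖ ^ 2 / 2))) := by
  have h : Real.exp (-(conj b * z).re) * Real.exp (-(‖z‖ ^ 2 / 2)) =
      Real.exp (‖b‖ ^ 2 / 2) * Real.exp (-(‖z + b‖ ^ 2 / 2)) := by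
    rw [← Real.exp_add, ← Real.exp_add]
    congr 1
    simp only [← Complex.normSq_eq_norm_sq, Complex.normSq_apply, Complex.add_re, Complex.add_im,
      Complex.mul_re, Complex.conj_re, Complex.conj_im]
    ring
  rw [norm_mul, norm_mul, Complex.norm_exp, Complex.neg_re]
  linear_combination ‖c‖ * ‖x‖ * h

/-- A Weyl translation moves `w` to the origin and changes the density only by a constant factor, so
the unweighted estimate at `0` applies. Dropping the Gaussian on the unit disc costs at most `exp (p
/ 2)`, uniformly in `w`. -/
theorem fockDensity_le_integral {p : ℝ} (hp : 1 ≤ p) {f : ℂ → ℂ} (hf : Differentiable ℂ f)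
    (w : ℂ) :
    fockDensity p f w ≤
      Real.pi⁻¹ * Real.exp (p / 2) * ∫ z in closedBall w 1, fockDensity p f z := by
  have hp0 : 0 ≤ p := zero_le_one.trans hp
  set h : ℂ → ℂ := fun η => 1 * Complex.exp (-(conj w * η)) * f (η + w) with hdef
  have hh : Differentiable ℂ h := by
    rw [hdef]
    have : Differentiable ℂ fun η => f (η + w) := hf.comp (differentiable_id.add_const w)
    fun_prop
  have hden (η : ℂ) : fockDensity p h η =
      Real.exp (p * ‖w‖ ^ 2 / 2) * fockDensity p f (η + w) := by
    rw [fockDensity_eq_rpow, fockDensity_eq_rpow, hdef, norm_weyl_mul_exp,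
      Real.mul_rpow (by positivity) (by positivity), norm_one, one_mul, ← Real.exp_mul]
    congr 2; ring
  have hshift : ∫ η in closedBall (0 : ℂ) 1, fockDensity p f (η + w) =
      ∫ z in closedBall w 1, fockDensity p f z := by
    have e := (measurePreserving_add_right volume w).setIntegral_preimage_emb
      (measurableEmbedding_addRight w) (fockDensity p f) (closedBall w 1)
    simpa [preimage_add_right_closedBall] using e
  have hint {g : ℂ → ℝ} (hg : Continuous g) : IntegrableOn g (closedBall (0 : ℂ) 1) :=
    hg.continuousOn.integrableOn_compact (isCompact_closedBall _ _)
  have hmono : ∫ η in closedBall (0 : ℂ) 1, ‖h η‖ ^ p ≤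
      ∫ η in closedBall (0 : ℂ) 1,
        Real.exp (p / 2) * (Real.exp (p * ‖w‖ ^ 2 / 2) * fockDensity p f (η + w)) := by
    refine setIntegral_mono_on (hint (hh.continuous.norm.rpow_const fun _ => Or.inr hp0))
      (hint ?_) isClosed_closedBall.measurableSet fun η hη => ?_
    · exact ((continuous_fockDensity hp0 hf.continuous).comp (continuous_add_const w)).const_mul _
        |>.const_mul _
    · rw [← hden, fockDensity, mul_left_comm, ← Real.exp_add]
      refine le_mul_of_one_le_right (by positivity) (Real.one_le_exp ?_)
      have : ‖η‖ ^ 2 ≤ 1 := pow_le_one₀ (norm_nonneg _) (by simpa using hη)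
      nlinarith
  have key := (norm_rpow_le_integral_closedBall hp hh).trans
    (mul_le_mul_of_nonneg_left hmono (by positivity))
  rw [integral_const_mul, integral_const_mul, hshift] at key
  have h0 : ‖h 0‖ ^ p = Real.exp (p * ‖w‖ ^ 2 / 2) * fockDensity p f w := by
    have := hden 0
    simpa [fockDensity] using this
  rw [h0] at key
  refine le_of_mul_le_mul_left (key.trans_eq ?_) (Real.exp_pos (p * ‖w‖ ^ 2 / 2))
  ring

/-! ### Rigidity: growth forces an affine symbol -/

/-- An entire function whose circle means over large circles grow at most linearly is affine. -/
theorem exists_affine_of_circleAverage_norm_le {ψ : ℂ → ℂ} (hψ : Differentiable ℂ ψ) {K : ℝ}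
    (h : ∀ R : ℝ, 1 ≤ R → Real.circleAverage (fun z => ‖ψ z‖) 0 R ≤ K * R) :
    ∃ a b : ℂ, ∀ z, ψ z = a * z + b := by
  set P := cauchyPowerSeries ψ 0 ((1 : NNReal) : ℝ) with hP
  have hser := hψ.hasFPowerSeriesOnBall 0 (R := 1) one_pos
  have hcoeff (n : ℕ) : P (n + 2) = 0 := by
    have hle (R : NNReal) (hR : 1 ≤ R) : ‖P (n + 2)‖ ≤ K * (R : ℝ)⁻¹ := by
      have hR0 : 0 < R := one_pos.trans_le hR
      have hR' : (1 : ℝ) ≤ R := hR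
      -- The Taylor series does not depend on the radius, so Cauchy's estimate is available on every
      -- circle and `R` can tend to infinity.
      have heq : P = cauchyPowerSeries ψ 0 (R : ℝ) :=
        hser.hasFPowerSeriesAt.eq_formalMultilinearSeries
          (hψ.hasFPowerSeriesOnBall 0 hR0).hasFPowerSeriesAt
      have hn := norm_cauchyPowerSeries_le ψ 0 R (n + 2)
      have hav := h R hR'
      rw [Real.circleAverage_def, smul_eq_mul] at hav
      rw [heq]
      refine hn.trans ((mul_le_mul_of_nonneg_right hav (by positivity)).trans ?_)
      have hK : 0 ≤ K := by
        have : 0 ≤ K * R := (mul_nonneg (by positivity) (intervalIntegral.integral_nonneg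
          (by positivity) fun _ _ => norm_nonneg _)).trans hav
        exact nonneg_of_mul_nonneg_left this (by linarith)
      rw [NNReal.abs_eq, mul_assoc]
      refine mul_le_mul_of_nonneg_left ?_ hK
      have h1 : (R : ℝ) * (R : ℝ)⁻¹ ^ (n + 2) = (R : ℝ)⁻¹ * (R : ℝ)⁻¹ ^ n := by
        have : (R : ℝ) ≠ 0 := by positivity
        rw [pow_add, sq]
        field_simp
      rw [h1]
      exact mul_le_of_le_one_right (by positivity) (pow_le_one₀ (by positivity) (inv_le_one_of_one_le₀ hR'))
    have hlim : Tendsto (fun m : ℕ => K * (((m + 1 : ℕ) : NNReal) : ℝ)⁻¹) atTop (𝓝 (K * 0)) := by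
      refine Tendsto.const_mul K ?_
      simpa using tendsto_one_div_add_atTop_nhds_zero_nat (𝕜 := ℝ)
    rw [mul_zero] at hlim
    have := ge_of_tendsto' hlim fun m : ℕ => hle ((m + 1 : ℕ) : NNReal) (by simp)
    exact norm_le_zero_iff.1 this
  refine ⟨P 1 fun _ => 1, P 0 fun _ => 0, fun z => ?_⟩
  have hs := hser.hasSum_sub (y := z) (by simp)
  have hfin : ∑ n ∈ Finset.range 2, P n (fun _ => z - 0) = ψ z := by
    refine (hasSum_sum_of_ne_finset_zero fun n hn => ?_).unique hs
    obtain ⟨m, rfl⟩ : ∃ m, n = m + 2 := ⟨n - 2, by simp at hn; omega⟩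
    rw [hcoeff]; rfl
  rw [← hfin, Finset.sum_range_succ, Finset.sum_range_one, sub_zero, add_comm]
  congr 1
  simp [mul_comm]

/-- A nowhere vanishing weight can only control `exp (|ψ|² / 2)` if `ψ` is affine. -/
theorem exists_affine_of_norm_mul_exp_le {u ψ : ℂ → ℂ} (hu : Differentiable ℂ u)
    (hψ : Differentiable ℂ ψ) (hu0 : ∀ z, u z ≠ 0) {M : ℝ}
    (hM : ∀ z, ‖u z‖ * Real.exp (‖ψ z‖ ^ 2 / 2) ≤ M * Real.exp (‖z‖ ^ 2 / 2)) :
    ∃ a b : ℂ, ∀ z, ψ z = a * z + b := by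
  set K : ℝ := 2 * Real.log M - 2 * Real.log ‖u 0‖ with hK
  have hMpos : 0 < M := by
    have h1 := hM 0
    have h2 : 0 < ‖u 0‖ * Real.exp (‖ψ 0‖ ^ 2 / 2) :=
      mul_pos (norm_pos_iff.2 (hu0 0)) (Real.exp_pos _)
    exact pos_of_mul_pos_left (h2.trans_le h1) (Real.exp_pos _).le
  have hlog (z : ℂ) : Real.log ‖u z‖ + ‖ψ z‖ ^ 2 / 2 ≤ Real.log M + ‖z‖ ^ 2 / 2 := by
    have := Real.log_le_log (mul_pos (norm_pos_iff.2 (hu0 z)) (Real.exp_pos _)) (hM z)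
    rwa [Real.log_mul (norm_ne_zero_iff.2 (hu0 z)) (Real.exp_pos _).ne',
      Real.log_mul hMpos.ne' (Real.exp_pos _).ne', Real.log_exp, Real.log_exp] at this
  refine exists_affine_of_circleAverage_norm_le hψ (K := |K| + 1) fun R hR => ?_
  have hR0 : 0 < R := one_pos.trans_le hR
  have hlogc : Continuous fun z => Real.log ‖u z‖ :=
    hu.continuous.norm.log fun z => norm_ne_zero_iff.2 (hu0 z)
  have hpt (z : ℂ) (hz : z ∈ sphere (0 : ℂ) |R|) :
      ‖ψ z‖ ≤ (R⁻¹ * Real.log M + R) + (-R⁻¹) * Real.log ‖u z‖ := by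
    have hz' : ‖z‖ = R := by simpa [abs_of_pos hR0] using hz
    have h1 := hlog z
    rw [hz'] at h1
    have h2 : R * ‖ψ z‖ ≤ R * ((R⁻¹ * Real.log M + R) + (-R⁻¹) * Real.log ‖u z‖) := by
      have : R * ((R⁻¹ * Real.log M + R) + (-R⁻¹) * Real.log ‖u z‖) =
          Real.log M + R ^ 2 - Real.log ‖u z‖ := by field_simp; ring
      rw [this]
      -- Uses `R * ‖ψ z‖ ≤ (R ^ 2 + ‖ψ z‖ ^ 2) / 2`, which makes the bound linear in `‖ψ z‖`.
      nlinarith [sq_nonneg (R - ‖ψ z‖)]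
    exact le_of_mul_le_mul_left h2 hR0
  have hci {g : ℂ → ℝ} (hg : Continuous g) : CircleIntegrable g 0 R :=
    ContinuousOn.circleIntegrable hR0.le hg.continuousOn
  have hav := Real.circleAverage_mono (hci hψ.continuous.norm)
    (hci (by fun_prop : Continuous fun z =>
      (R⁻¹ * Real.log M + R) + (-R⁻¹) * Real.log ‖u z‖)) hpt
  have han : AnalyticOnNhd ℂ u (closedBall 0 |R|) := fun z _ => hu.analyticAt z
  -- Harmonicity of `log |u|` replaces its circle mean by its value at `0`, so no lower bound for
  -- `u` on the circle is needed.
  have hlu := han.circleAverage_log_norm_of_ne_zero fun z _ => hu0 z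
  have hrhs : Real.circleAverage
      (fun z => (R⁻¹ * Real.log M + R) + (-R⁻¹) * Real.log ‖u z‖) 0 R =
        R⁻¹ * Real.log M + R + (-R⁻¹) * Real.log ‖u 0‖ := by
    rw [Real.circleAverage_fun_add (hci continuous_const) (hci (hlogc.const_mul _)),
      Real.circleAverage_const, ← hlu]
    congr 1
    exact Real.circleAverage_fun_smul (a := -R⁻¹) (f := fun z => Real.log ‖u z‖)
  rw [hrhs] at hav
  refine hav.trans ?_
  have e : R⁻¹ * Real.log M + R + -R⁻¹ * Real.log ‖u 0‖ = R⁻¹ * (K / 2) + R := by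
    rw [hK]; ring
  rw [e]
  have h3 : R⁻¹ * (K / 2) ≤ |K| :=
    (mul_le_mul_of_nonneg_left (by linarith [le_abs_self K, abs_nonneg K] : K / 2 ≤ |K|)
      (by positivity)).trans (mul_le_of_le_one_left (abs_nonneg _) (inv_le_one_of_one_le₀ hR))
  nlinarith [abs_nonneg K]

/-! ### Orbits of affine maps -/

/-- No orbit of an affine map of the complex plane is dense. -/
theorem exists_forall_le_norm_sub_of_affine_recurrence {r : ℕ → ℂ} {a α : ℂ}
    (hr : ∀ n, r (n + 1) = α + a * r n) : ∃ τ : ℂ, ∃ ε > 0, ∀ n, ε ≤ ‖r n - τ‖ := by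
  by_cases ha : a = 1
  · have hn (n : ℕ) : r n = r 0 + n * α := by
      induction n with
      | zero => simp
      | succ k ih => rw [hr, ih, ha]; push_cast; ring
    by_cases hα : α = 0
    · exact ⟨r 0 + 1, 1, one_pos, fun n => by rw [hn n, hα]; simp⟩
    -- The point one step before the start of the progression is missed by at least one step length.
    · refine ⟨r 0 - α, ‖α‖, norm_pos_iff.2 hα, fun n => ?_⟩
      have : r n - (r 0 - α) = ((n + 1 : ℕ) : ℂ) * α := by rw [hn]; push_cast; ring
      rw [this, norm_mul, Complex.norm_natCast]
      exact le_mul_of_one_le_left (norm_nonneg _) (by simp)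
  · have ha' : 1 - a ≠ 0 := sub_ne_zero.2 (Ne.symm ha)
    set ρ := α / (1 - a) with hρ
    have hα : α = ρ * (1 - a) := by rw [hρ]; field_simp
    have hn (n : ℕ) : r n - ρ = a ^ n * (r 0 - ρ) := by
      induction n with
      | zero => simp
      | succ k ih => rw [hr, pow_succ]; linear_combination a * ih + hα
    have hnn (n : ℕ) : ‖r n - ρ‖ = ‖a‖ ^ n * ‖r 0 - ρ‖ := by rw [hn, norm_mul, norm_pow]
    -- Around the fixed point `ρ` the orbit either never comes closer than it started, and misses
    -- `ρ`, or never goes farther, and misses a point outside that disc.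
    by_cases hbig : 1 < ‖a‖ ∧ r 0 ≠ ρ
    · refine ⟨ρ, ‖r 0 - ρ‖, norm_pos_iff.2 (sub_ne_zero.2 hbig.2), fun n => ?_⟩
      rw [hnn n]
      exact le_mul_of_one_le_left (norm_nonneg _) (one_le_pow₀ hbig.1.le)
    · have hle (n : ℕ) : ‖r n - ρ‖ ≤ ‖r 0 - ρ‖ := by
        rw [hnn n]
        by_cases h0 : r 0 = ρ
        · simp [h0]
        · exact mul_le_of_le_one_left (norm_nonneg _)
            (pow_le_one₀ (norm_nonneg _) (not_lt.1 fun h => hbig ⟨h, h0⟩))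
      refine ⟨ρ + ((‖r 0 - ρ‖ + 1 : ℝ) : ℂ), 1, one_pos, fun n => ?_⟩
      have h1 := norm_sub_norm_le (((‖r 0 - ρ‖ + 1 : ℝ) : ℂ)) (r n - ρ)
      rw [Complex.norm_real, Real.norm_of_nonneg (by positivity)] at h1
      have h2 : r n - (ρ + ((‖r 0 - ρ‖ + 1 : ℝ) : ℂ)) =
          -(((‖r 0 - ρ‖ + 1 : ℝ) : ℂ) - (r n - ρ)) := by ring
      rw [h2, norm_neg]
      linarith [hle n]

/-! ### Point evaluations, exponentials and logarithmic derivatives -/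

namespace FockSpace

variable {p : ℝ} [hp : Fact (1 ≤ p)]

theorem differentiable (f : FockSpace p) : Differentiable ℂ (f : ℂ → ℂ) := f.memFock.1

theorem integrable_fockDensity (f : FockSpace p) : Integrable (fockDensity p f) := f.memFock.2

theorem norm_eq_integral_fockDensity (f : FockSpace p) :
    ‖f‖ = (p / (2 * Real.pi) * ∫ z, fockDensity p f z) ^ (1 / p) := rfl

/-- The growth `exp (|z| ^ 2 / 2)` has the same exponent as the norm in `norm_expFun`; this match
yields the sharp bound on the weight. -/
theorem exists_norm_mul_exp_le (p : ℝ) [hp : Fact (1 ≤ p)] : ∃ C : ℝ, 0 ≤ C ∧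
    ∀ (f : FockSpace p) (z : ℂ), ‖f z‖ * Real.exp (-(‖z‖ ^ 2 / 2)) ≤ C * ‖f‖ := by
  have hp0 : 0 < p := one_pos.trans_le hp.out
  have hpi := Real.pi_pos
  refine ⟨(Real.pi⁻¹ * Real.exp (p / 2) / (p / (2 * Real.pi))) ^ (1 / p), by positivity,
    fun f z => ?_⟩
  have hI : 0 ≤ ∫ z, fockDensity p f z := integral_nonneg fun z => fockDensity_nonneg p f z
  have h1 := (fockDensity_le_integral hp.out f.differentiable z).trans
    (mul_le_mul_of_nonneg_left (setIntegral_le_integral f.integrable_fockDensity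
      (Eventually.of_forall fun z => fockDensity_nonneg p f z)) (by positivity))
  rw [fockDensity_eq_rpow] at h1
  have h2 := Real.rpow_le_rpow (by positivity) h1 (by positivity : 0 ≤ 1 / p)
  rw [one_div, Real.rpow_rpow_inv (by positivity) hp0.ne'] at h2
  rw [norm_eq_integral_fockDensity, one_div, ← Real.mul_rpow (by positivity) (by positivity)]
  refine h2.trans_eq ?_
  congr 1
  field_simp

theorem exists_norm_apply_le_of_norm_le (p : ℝ) [hp : Fact (1 ≤ p)] (R : ℝ) : ∃ C : ℝ, 0 ≤ C ∧
    ∀ (f : FockSpace p) (z : ℂ), ‖z‖ ≤ R → ‖f z‖ ≤ C * ‖f‖ := by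
  obtain ⟨C, hC, h⟩ := exists_norm_mul_exp_le p
  refine ⟨C * Real.exp (R ^ 2 / 2), by positivity, fun f z hz => ?_⟩
  have h1 := h f z
  rw [Real.exp_neg, ← div_eq_mul_inv, div_le_iff₀ (Real.exp_pos _)] at h1
  have h2 : ‖z‖ ^ 2 ≤ R ^ 2 := pow_le_pow_left₀ (norm_nonneg _) hz 2
  calc ‖f z‖ ≤ C * ‖f‖ * Real.exp (‖z‖ ^ 2 / 2) := h1
    _ ≤ C * ‖f‖ * Real.exp (R ^ 2 / 2) := by gcongr
    _ = _ := by ring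

theorem continuous_apply (z : ℂ) : Continuous fun f : FockSpace p => f z := by
  obtain ⟨C, -, h⟩ := exists_norm_apply_le_of_norm_le p ‖z‖
  let L : FockSpace p →ₗ[ℂ] ℂ :=
    { toFun := fun f => f z, map_add' := fun _ _ => rfl, map_smul' := fun _ _ => rfl }
  exact (L.mkContinuous C fun f => h f z le_rfl).continuous

theorem continuous_deriv_apply (z : ℂ) : Continuous fun f : FockSpace p => deriv f z := by
  obtain ⟨C, -, h⟩ := exists_norm_apply_le_of_norm_le p (‖z‖ + 1)
  let L : FockSpace p →ₗ[ℂ] ℂ :=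
    { toFun := fun f => deriv f z
      map_add' := fun f g => by
        rw [coe_add, deriv_add f.differentiable.differentiableAt g.differentiable.differentiableAt]
      map_smul' := fun c f => by
        rw [coe_smul, deriv_const_smul c f.differentiable.differentiableAt]; rfl }
  refine (L.mkContinuous C fun f => ?_).continuous
  have := Complex.norm_deriv_le_of_forall_mem_sphere_norm_le (c := z) (C := C * ‖f‖) one_pos
    f.differentiable.diffContOnCl fun w hw => h f w ?_
  · rw [div_one] at this
    exact this
  · have h1 := norm_add_le z (w - z)
    rw [mem_sphere_iff_norm] at hw
    simpa [hw] using h1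

theorem continuousAt_logDeriv {z : ℂ} {f : FockSpace p} (hf : f z ≠ 0) :
    ContinuousAt (fun g : FockSpace p => logDeriv g z) f :=
  (continuous_deriv_apply z).continuousAt.div (continuous_apply z).continuousAt hf

theorem fockDensity_exp (p : ℝ) (τ z : ℂ) :
    fockDensity p (fun z => Complex.exp (τ * z)) z =
      Real.exp (p * ‖τ‖ ^ 2 / 2) * fockDensity p (fun _ => 1) (z + -conj τ) := by
  have h := norm_weyl_mul_exp 1 (-conj τ) z 1
  simp only [map_neg, Complex.conj_conj, neg_mul, neg_neg, one_mul, mul_one, norm_one,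
    norm_neg, RCLike.norm_conj] at h
  rw [fockDensity_eq_rpow, fockDensity_eq_rpow, h, Real.mul_rpow (by positivity) (by positivity),
    ← Real.exp_mul, norm_one, one_mul]
  congr 2; ring

theorem memFock_exp (τ : ℂ) : MemFock p fun z => Complex.exp (τ * z) := by
  have hp0 : 0 < p := one_pos.trans_le hp.out
  refine ⟨by fun_prop, ?_⟩
  have h1 : Integrable (fockDensity p fun _ => 1) := by
    have h := GaussianFourier.integrable_cexp_neg_mul_sq_norm_add (V := ℂ) (b := (p / 2 : ℝ))
      (by simpa using hp0) 0 0
    refine h.norm.congr (Eventually.of_forall fun z => ?_)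
    simp only [fockDensity, Complex.norm_exp, norm_one, Real.one_rpow, one_mul]
    congr 1
    simp [← Complex.ofReal_pow]
    ring
  change Integrable (fockDensity p fun z => Complex.exp (τ * z))
  simp only [funext (fockDensity_exp p τ)]
  exact (h1.comp_add_right _).const_mul _

/-- The function `z ↦ exp (τ z)` as an element of the Fock space. -/
noncomputable def expFun (p : ℝ) [Fact (1 ≤ p)] (τ : ℂ) : FockSpace p :=
  mk (fun z => Complex.exp (τ * z)) (memFock_exp τ)

@[simp] theorem expFun_apply (τ z : ℂ) : expFun p τ z = Complex.exp (τ * z) := rfl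

/-- Up to a factor, `exp (τ z)` is a Weyl translate of the constant `1`, and area measure is
translation invariant. -/
theorem norm_expFun (τ : ℂ) : ‖expFun p τ‖ = Real.exp (‖τ‖ ^ 2 / 2) * ‖expFun p 0‖ := by
  have hp0 : 0 < p := one_pos.trans_le hp.out
  have hpi := Real.pi_pos
  have h (σ : ℂ) : ‖expFun p σ‖ =
      Real.exp (‖σ‖ ^ 2 / 2) * (p / (2 * Real.pi) * ∫ z, fockDensity p (fun _ => 1) z) ^ (1 / p) := by
    have hI : 0 ≤ ∫ z, fockDensity p (fun _ => 1) z :=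
      integral_nonneg fun z => fockDensity_nonneg p _ z
    have e : Real.exp (‖σ‖ ^ 2 / 2) = Real.exp (p * ‖σ‖ ^ 2 / 2) ^ (1 / p) := by
      rw [← Real.exp_mul]
      congr 1
      field_simp
    rw [e, ← Real.mul_rpow (by positivity) (by positivity), norm_eq_integral_fockDensity]
    congr 1
    change _ * (∫ z, fockDensity p (fun z => Complex.exp (σ * z)) z) = _
    simp only [fockDensity_exp]
    rw [integral_const_mul, integral_add_right_eq_self (fockDensity p fun _ => 1)]
    ring
  rw [h τ, h 0]
  simp

theorem logDeriv_expFun (τ z : ℂ) : logDeriv (expFun p τ) z = τ := by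
  have h : HasDerivAt (fun z => Complex.exp (τ * z)) (Complex.exp (τ * z) * (τ * 1)) z :=
    ((hasDerivAt_id z).const_mul τ).cexp
  rw [logDeriv_apply]
  change deriv (fun z => Complex.exp (τ * z)) z / Complex.exp (τ * z) = τ
  rw [h.deriv, mul_one, mul_div_cancel_left₀ _ (Complex.exp_ne_zero _)]

theorem logDeriv_smul {c : ℂ} (hc : c ≠ 0) (f : FockSpace p) (z : ℂ) :
    logDeriv (c • f : FockSpace p) z = logDeriv f z :=
  logDeriv_const_mul z c hc

/-- The logarithmic derivatives along a dense projective orbit are dense, even if only elements in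
a neighbourhood of an exponential are used. -/
theorem exists_norm_logDeriv_sub_lt {W : FockSpace p →L[ℂ] FockSpace p} {f : FockSpace p}
    (hf : Dense {g : FockSpace p | ∃ (c : ℂ) (n : ℕ), g = c • (W ^ n) f}) (z τ : ℂ) {ε : ℝ}
    (hε : 0 < ε) {U : Set (FockSpace p)} (hU : IsOpen U) (hτ : expFun p τ ∈ U) :
    ∃ (c : ℂ) (n : ℕ), c • (W ^ n) f ∈ U ∧ c ≠ 0 ∧ (W ^ n) f z ≠ 0 ∧
      ‖logDeriv ((W ^ n) f) z - τ‖ < ε := by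
  have hne : expFun p τ z ≠ 0 := Complex.exp_ne_zero _
  have h1 : ∀ᶠ g : FockSpace p in 𝓝 (expFun p τ), g z ≠ 0 :=
    (continuous_apply z).continuousAt.eventually_ne hne
  have h2 : ∀ᶠ g : FockSpace p in 𝓝 (expFun p τ), ‖logDeriv g z - τ‖ < ε := by
    have := (continuousAt_logDeriv hne).eventually (ball_mem_nhds _ hε)
    simpa only [logDeriv_expFun, mem_ball, dist_eq_norm] using this
  obtain ⟨g, ⟨c, n, rfl⟩, ⟨hg1, hg2⟩, hgU⟩ :=
    hf.inter_nhds_nonempty ((h1.and h2).and (hU.mem_nhds hτ))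
  have hc : c ≠ 0 := by
    rintro rfl
    simp at hg1
  refine ⟨c, n, hgU, hc, fun h0 => hg1 ?_, ?_⟩
  · rw [coe_smul, Pi.smul_apply, h0, smul_zero]
  · rwa [logDeriv_smul hc] at hg2

end FockSpace

/-! ### Decay at infinity and Weyl translations -/

namespace FockSpace

variable {p : ℝ} [hp : Fact (1 ≤ p)]

/-- The weighted modulus of an element of the Fock space tends to zero along an arithmetic
progression. -/
theorem tendsto_norm_mul_exp_natCast_mul (f : FockSpace p) {b : ℂ} (hb : b ≠ 0) :
    Tendsto (fun n : ℕ => ‖f (n * b)‖ * Real.exp (-(‖n * b‖ ^ 2 / 2))) atTop (𝓝 0) := by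
  have hp0 : 0 < p := one_pos.trans_le hp.out
  have hnb : Tendsto (fun n : ℕ => ‖n * b‖) atTop atTop := by
    simpa using (tendsto_natCast_atTop_atTop (R := ℝ)).atTop_mul_const (norm_pos_iff.2 hb)
  have hlim : Tendsto (fun n : ℕ => ∫ z in closedBall (n * b) 1, fockDensity p f z) atTop
      (𝓝 0) := by
    -- The discs escape to infinity, so the indicators tend to zero pointwise, dominated by the
    -- integrable density of `f`.
    have h : Tendsto (fun n : ℕ => ∫ z, (closedBall (n * b) 1).indicator (fockDensity p f) z)
        atTop (𝓝 (∫ _ : ℂ, (0 : ℝ))) := by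
      refine tendsto_integral_of_dominated_convergence (fockDensity p f)
        (fun n => f.integrable_fockDensity.aestronglyMeasurable.indicator
          isClosed_closedBall.measurableSet) f.integrable_fockDensity (fun n => ?_) ?_
      · refine Eventually.of_forall fun z => ?_
        refine (norm_indicator_le_norm_self _ _).trans_eq ?_
        rw [Real.norm_of_nonneg (fockDensity_nonneg p f z)]
      · refine Eventually.of_forall fun z => tendsto_const_nhds.congr' ?_
        filter_upwards [hnb.eventually_gt_atTop (‖z‖ + 1)] with n hn
        refine (Set.indicator_of_notMem (fun hz => ?_) _).symm
        rw [mem_closedBall_iff_norm'] at hz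
        linarith [norm_sub_norm_le (n * b) z]
    simpa [integral_indicator isClosed_closedBall.measurableSet] using h
  have hden : Tendsto (fun n : ℕ => fockDensity p f (n * b)) atTop (𝓝 0) := by
    refine squeeze_zero (fun n => fockDensity_nonneg p f _)
      (fun n => fockDensity_le_integral hp.out f.differentiable _) ?_
    simpa using hlim.const_mul (Real.pi⁻¹ * Real.exp (p / 2))
  have hroot := hden.rpow_const (p := p⁻¹) (Or.inr (by positivity))
  rw [Real.zero_rpow (inv_ne_zero hp0.ne')] at hroot
  refine hroot.congr fun n => ?_
  rw [fockDensity_eq_rpow, Real.rpow_rpow_inv (by positivity) hp0.ne']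

/-- Weyl translations act on the Fock space by multiples of isometries. -/
theorem norm_eq_of_weyl {f g : FockSpace p} {b c : ℂ}
    (h : ∀ z, g z = c * Complex.exp (-(conj b * z)) * f (z + b)) :
    ‖g‖ = ‖c‖ * Real.exp (‖b‖ ^ 2 / 2) * ‖f‖ := by
  have hp0 : 0 < p := one_pos.trans_le hp.out
  have hpi := Real.pi_pos
  set s := ‖c‖ * Real.exp (‖b‖ ^ 2 / 2) with hs
  have hs0 : 0 ≤ s := by positivity
  have hden (z : ℂ) : fockDensity p g z = s ^ p * fockDensity p f (z + b) := by
    rw [fockDensity_eq_rpow, fockDensity_eq_rpow, h, norm_weyl_mul_exp,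
      Real.mul_rpow hs0 (by positivity)]
  have hI : 0 ≤ ∫ z, fockDensity p f z := integral_nonneg fun z => fockDensity_nonneg p f z
  have e : s = (s ^ p) ^ (1 / p) := by rw [one_div, Real.rpow_rpow_inv hs0 hp0.ne']
  rw [norm_eq_integral_fockDensity, norm_eq_integral_fockDensity, e,
    ← Real.mul_rpow (by positivity) (by positivity)]
  congr 1
  simp only [hden]
  rw [integral_const_mul, integral_add_right_eq_self (fockDensity p f)]
  ring

end FockSpace

/-! ### The cases of the theorem -/

open FockSpace

variable {p : ℝ} [hp : Fact (1 ≤ p)]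

theorem IsWeightedComposition.pow_succ_apply {u ψ : ℂ → ℂ} {W : FockSpace p →L[ℂ] FockSpace p}
    (hW : IsWeightedComposition u ψ W) (n : ℕ) (f : FockSpace p) (z : ℂ) :
    (W ^ (n + 1)) f z = u z * (W ^ n) f (ψ z) := by
  rw [pow_succ', mul_apply_eq_comp, hW]

/-- A weighted composition operator whose weight has a zero is not supercyclic. -/
theorem IsWeightedComposition.not_isSupercyclic_of_eq_zero {u ψ : ℂ → ℂ}
    {W : FockSpace p →L[ℂ] FockSpace p} (hW : IsWeightedComposition u ψ W) {z : ℂ}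
    (hz : u z = 0) : ¬ IsSupercyclic W := by
  rintro ⟨f, hf⟩
  -- The target lies at distance exactly `1` from the value for `n = 0`, so the strict inequality
  -- excludes that index.
  obtain ⟨c, n, -, -, hn, hlt⟩ := exists_norm_logDeriv_sub_lt hf z (logDeriv f z + 1)
    one_pos isOpen_univ (Set.mem_univ _)
  cases n with
  | zero => simp at hlt
  | succ k => exact hn (by rw [hW.pow_succ_apply, hz, zero_mul])

/-- A weighted composition operator whose symbol has a fixed point is not supercyclic. -/
theorem IsWeightedComposition.not_isSupercyclic_of_fixedPoint {u ψ : ℂ → ℂ}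
    {W : FockSpace p →L[ℂ] FockSpace p} (hW : IsWeightedComposition u ψ W)
    (hu : Differentiable ℂ u) (hψ : Differentiable ℂ ψ) {z : ℂ} (hz : ψ z = z) :
    ¬ IsSupercyclic W := by
  by_cases huz : u z = 0
  · exact hW.not_isSupercyclic_of_eq_zero huz
  rintro ⟨f, hf⟩
  have hval (n : ℕ) : (W ^ n) f z = u z ^ n * f z := by
    induction n with
    | zero => simp
    | succ k ih => rw [hW.pow_succ_apply, hz, ih, pow_succ']; ring
  have hfz : f z ≠ 0 := by
    obtain ⟨c, n, -, -, hn, -⟩ := exists_norm_logDeriv_sub_lt hf z 0 one_pos isOpen_univ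
      (Set.mem_univ _)
    rw [hval] at hn
    exact right_ne_zero_of_mul hn
  have hne (n : ℕ) : (W ^ n) f z ≠ 0 := by
    rw [hval]
    exact mul_ne_zero (pow_ne_zero _ huz) hfz
  have hrec (n : ℕ) : logDeriv ((W ^ (n + 1)) f) z =
      logDeriv u z + deriv ψ z * logDeriv ((W ^ n) f) z := by
    have hfun : ((W ^ (n + 1)) f : ℂ → ℂ) = fun w => u w * (((W ^ n) f : ℂ → ℂ) ∘ ψ) w :=
      funext fun w => hW.pow_succ_apply n f w
    have hd : Differentiable ℂ (((W ^ n) f : ℂ → ℂ) ∘ ψ) := ((W ^ n) f).differentiable.comp hψ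
    rw [hfun, logDeriv_mul z huz (by rw [Function.comp_apply, hz]; exact hne n) (hu z) (hd z),
      logDeriv_comp ((W ^ n) f).differentiable.differentiableAt (hψ z), hz, mul_comm (deriv ψ z)]
  obtain ⟨τ, ε, hε, hle⟩ := exists_forall_le_norm_sub_of_affine_recurrence
    (r := fun n => logDeriv ((W ^ n) f) z) hrec
  obtain ⟨c, n, -, -, -, hlt⟩ := exists_norm_logDeriv_sub_lt hf z τ hε isOpen_univ
    (Set.mem_univ _)
  exact (hle n).not_gt hlt

/-- Boundedness of a weighted composition operator bounds its weight, by testing on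
exponentials. -/
theorem IsWeightedComposition.exists_norm_mul_exp_le {u ψ : ℂ → ℂ}
    {W : FockSpace p →L[ℂ] FockSpace p} (hW : IsWeightedComposition u ψ W) :
    ∃ M : ℝ, ∀ z, ‖u z‖ * Real.exp (‖ψ z‖ ^ 2 / 2) ≤ M * Real.exp (‖z‖ ^ 2 / 2) := by
  obtain ⟨C, hC, h⟩ := FockSpace.exists_norm_mul_exp_le p
  refine ⟨C * (‖W‖ * ‖expFun p 0‖), fun z => ?_⟩
  -- This exponential takes the value `exp (‖ψ z‖ ^ 2)` at `ψ z`, while its norm grows only like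
  -- `exp (‖ψ z‖ ^ 2 / 2)`.
  have h1 := (h (W (expFun p (conj (ψ z)))) z).trans
    (mul_le_mul_of_nonneg_left (W.le_opNorm _) hC)
  have h2 : (conj (ψ z) * ψ z).re = ‖ψ z‖ ^ 2 := by
    rw [← Complex.normSq_eq_conj_mul_self, Complex.ofReal_re, Complex.normSq_eq_norm_sq]
  rw [hW, expFun_apply, norm_mul, Complex.norm_exp, h2, norm_expFun, RCLike.norm_conj,
    Real.exp_neg, ← div_eq_mul_inv, div_le_iff₀ (Real.exp_pos _)] at h1
  have h3 : Real.exp (‖ψ z‖ ^ 2) = Real.exp (‖ψ z‖ ^ 2 / 2) * Real.exp (‖ψ z‖ ^ 2 / 2) := by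
    rw [← Real.exp_add]; congr 1; ring
  rw [h3] at h1
  refine le_of_mul_le_mul_right (a := Real.exp (‖ψ z‖ ^ 2 / 2)) ?_ (Real.exp_pos _)
  linarith

/-- Multiples of Weyl translations are not supercyclic. -/
theorem IsWeightedComposition.not_isSupercyclic_of_translation {b c : ℂ} (hb : b ≠ 0)
    {W : FockSpace p →L[ℂ] FockSpace p}
    (hW : IsWeightedComposition (fun z => c * Complex.exp (-(conj b * z))) (fun z => z + b) W) :
    ¬ IsSupercyclic W := by
  rintro ⟨f, hf⟩
  set s := ‖c‖ * Real.exp (‖b‖ ^ 2 / 2) with hs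
  have hnorm (n : ℕ) : ‖(W ^ n) f‖ = s ^ n * ‖f‖ := by
    induction n with
    | zero => simp
    | succ k ih =>
      rw [norm_eq_of_weyl (fun z => hW.pow_succ_apply k f z), ih, ← hs, pow_succ']; ring
  have hval (n : ℕ) : ∀ z, ‖(W ^ n) f z‖ * Real.exp (-(‖z‖ ^ 2 / 2)) =
      s ^ n * (‖f (z + n * b)‖ * Real.exp (-(‖z + n * b‖ ^ 2 / 2))) := by
    induction n with
    | zero => simp
    | succ k ih =>
      intro z
      have e : z + b + k * b = z + (k + 1 : ℕ) * b := by push_cast; ring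
      rw [hW.pow_succ_apply, norm_weyl_mul_exp, ih, e, ← hs, pow_succ']
      ring
  have hval0 (n : ℕ) : ‖(W ^ n) f 0‖ =
      s ^ n * (‖f (n * b)‖ * Real.exp (-(‖n * b‖ ^ 2 / 2))) := by simpa using hval n 0
  have hN : 0 < ‖expFun p 0‖ := by
    refine norm_pos_iff.2 fun h0 => ?_
    have : (expFun p 0 : ℂ → ℂ) 0 = 0 := by rw [h0]; rfl
    simp at this
  -- Chosen so that `δ * ‖expFun p τ‖ ≤ 1 / 2` for `‖τ‖ ≤ 1`, while the value at `0` is `1`.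
  set δ := (2 * Real.exp (1 / 2) * ‖expFun p 0‖)⁻¹ with hδ
  have hδ0 : 0 < δ := by positivity
  set U : Set (FockSpace p) := {g | δ * ‖g‖ < ‖g 0‖}
  have hUmem (g : FockSpace p) : g ∈ U ↔ δ * ‖g‖ < ‖g 0‖ := Iff.rfl
  have hU : IsOpen U := isOpen_lt (continuous_const.mul continuous_norm) (FockSpace.continuous_apply 0).norm
  have hmem (τ : ℂ) (hτ : ‖τ‖ ≤ 1) : expFun p τ ∈ U := by
    rw [hUmem, norm_expFun]
    have h1 : Real.exp (‖τ‖ ^ 2 / 2) ≤ Real.exp (1 / 2) := by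
      have := pow_le_one₀ (n := 2) (norm_nonneg τ) hτ
      gcongr
    calc δ * (Real.exp (‖τ‖ ^ 2 / 2) * ‖expFun p 0‖)
        ≤ δ * (Real.exp (1 / 2) * ‖expFun p 0‖) := by gcongr
      _ = 1 / 2 := by rw [hδ]; field_simp
      _ < ‖(expFun p τ : ℂ → ℂ) 0‖ := by simp; norm_num
  obtain ⟨c₀, n₀, hmem₀, -⟩ := exists_norm_logDeriv_sub_lt hf 0 0 one_pos hU
    (hmem 0 (by simp))
  have hf0 : 0 < ‖f‖ := by
    refine norm_pos_iff.2 fun h0 => ?_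
    rw [hUmem, h0, map_zero, smul_zero] at hmem₀
    simp at hmem₀
  obtain ⟨N, hNbound⟩ := eventually_atTop.1
    ((tendsto_norm_mul_exp_natCast_mul f hb).eventually_lt_const (mul_pos hδ0 hf0))
  have hs0 : 0 ≤ s := by positivity
  -- Both sides of the condition defining `U` carry the factor `‖a‖ * s ^ n`, so only the decay of
  -- `f` along the multiples of `b` matters.
  have hlarge (a : ℂ) (n : ℕ) (h : a • (W ^ n) f ∈ U) : n < N := by
    by_contra! hn
    rw [hUmem, coe_smul, Pi.smul_apply, norm_smul, norm_smul, hnorm,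
      hval0] at h
    have h1 := mul_le_mul_of_nonneg_left (hNbound n hn).le
      (mul_nonneg (norm_nonneg a) (pow_nonneg hs0 n))
    linarith
  set S : Set ℂ := (fun n : ℕ => logDeriv ((W ^ n) f) 0) '' Set.Iio N with hS
  have hSfin : S.Finite := (Set.finite_Iio N).image _
  have hsub : closedBall (0 : ℂ) 1 ⊆ S := by
    intro τ hτ
    rw [← hSfin.isClosed.closure_eq]
    refine Metric.mem_closure_iff.2 fun ε hε => ?_
    obtain ⟨a, n, hn, -, -, hlt⟩ := exists_norm_logDeriv_sub_lt hf 0 τ hε hU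
      (hmem τ (by simpa using hτ))
    exact ⟨_, ⟨n, hlarge a n hn, rfl⟩, by rwa [dist_comm, dist_eq_norm]⟩
  exact (infinite_of_mem_nhds (0 : ℂ) (closedBall_mem_nhds 0 one_pos)) (hSfin.subset hsub)

theorem theorem2p1 (p : ℝ) [Fact (1 ≤ p)] (u ψ : ℂ → ℂ)
    (hu : Differentiable ℂ u) (hψ : Differentiable ℂ ψ)
    (W : FockSpace p →L[ℂ] FockSpace p) (hW : IsWeightedComposition u ψ W) :
    ¬ IsSupercyclic W := by
  by_cases hu0 : ∃ z, u z = 0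
  · obtain ⟨z, hz⟩ := hu0
    exact hW.not_isSupercyclic_of_eq_zero hz
  by_cases hfix : ∃ z, ψ z = z
  · obtain ⟨z, hz⟩ := hfix
    exact hW.not_isSupercyclic_of_fixedPoint hu hψ hz
  push Not at hu0 hfix
  obtain ⟨M, hM⟩ := hW.exists_norm_mul_exp_le
  obtain ⟨a, b, hab⟩ := exists_affine_of_norm_mul_exp_le hu hψ hu0 hM
  obtain rfl : a = 1 := by
    by_contra ha
    have ha' : 1 - a ≠ 0 := sub_ne_zero.2 (Ne.symm ha)
    refine hfix (b / (1 - a)) ?_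
    rw [hab]
    field_simp
    ring
  have hψ' : ψ = fun z => z + b := funext fun z => by rw [hab, one_mul]
  have hb : b ≠ 0 := by
    rintro rfl
    exact hfix 0 (by simp [hψ'])
  subst hψ'
  have hvd : Differentiable ℂ fun z => u z * Complex.exp (conj b * z) := by fun_prop
  -- Completing the square in the weight bound for `ψ z = z + b` leaves exactly this product
  -- bounded; by Liouville it is constant.
  have hbdd : Bornology.IsBounded (Set.range fun z => u z * Complex.exp (conj b * z)) := by
    refine (isBounded_iff_forall_norm_le).2 ⟨M * Real.exp (-(‖b‖ ^ 2 / 2)), ?_⟩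
    rintro _ ⟨z, rfl⟩
    have e : Real.exp (conj b * z).re * Real.exp (‖z‖ ^ 2 / 2) =
        Real.exp (-(‖b‖ ^ 2 / 2)) * Real.exp (‖z + b‖ ^ 2 / 2) := by
      rw [← Real.exp_add, ← Real.exp_add]
      congr 1
      simp only [← Complex.normSq_eq_norm_sq, Complex.normSq_apply, Complex.add_re,
        Complex.add_im, Complex.mul_re, Complex.conj_re, Complex.conj_im]
      ring
    rw [norm_mul, Complex.norm_exp]
    refine le_of_mul_le_mul_right (a := Real.exp (‖z‖ ^ 2 / 2)) ?_ (Real.exp_pos _)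
    have h1 := mul_le_mul_of_nonneg_left (hM z) (Real.exp_pos (-(‖b‖ ^ 2 / 2))).le
    linear_combination h1 + ‖u z‖ * e
  have hconst (z : ℂ) : u z = u 0 * Complex.exp (-(conj b * z)) := by
    have h1 : u z * Complex.exp (conj b * z) = u 0 * Complex.exp (conj b * 0) :=
      hvd.apply_eq_apply_of_bounded hbdd z 0
    rw [mul_zero, Complex.exp_zero, mul_one] at h1
    rw [← h1, mul_assoc, ← Complex.exp_add]
    simp
  rw [funext hconst] at hW
  exact hW.not_isSupercyclic_of_translation hb
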